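/- Let $k \ge 0$, let $a_1,\dots,a_k$ be nonnegative integers, let $n = a_1+\cdots+a_k$, and let $S \subseteq \{1,\dots,k\}$. Partition $\{1,\dots,n\}$ into consecutive intervals ("blocks") $A_1,\dots,A_k$ with $|A_i| = a_i$. Call the block $A_i$ descending if $i \in S$ and ascending if $i \notin S$. An $(A,S)$-derangement is a permutation $\pi$ of $\{1,\dots,n\}$ without fixed points such that $\pi$ is decreasing on $A_i$ for every $i \in S$ and increasing on $A_i$ for every $i \notin S$. A cycle of a permutation of $\{1,\dots,n\}$ (fixed points are cycles of length $1$) is called small if all of its elements lie in a single block $A_i$; it is then a small cycle in $A_i$. Let $D$ be the number of $(A,S)$-derangements, and let $E$ be the number of permutations of $\{1,\dots,n\}$ such that - there are no small cycles in ascending blocks, and - for each descending block, the total length of all small cycles in that block is even. Then $$E = a_1!\,a_2!\cdots a_k!\; D.$$ -/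

import Mathlib

/-- The blocks `A_1, …, A_k`: consecutive intervals partitioning the ground set `Fin (a_1 + ⋯ + a_k)`
(positions are counted from `0`), the block `A_i` having size `a_i`. -/
def ascDescBlock {k : ℕ} (a : Fin k → ℕ) (i : Fin k) : Finset (Fin (∑ j, a j)) :=
  {x | ∑ j with j < i, a j ≤ (x : ℕ) ∧ (x : ℕ) < ∑ j with j ≤ i, a j}

/-- An `(A, S)`-permutation: it descends in the blocks `A_i` with `i ∈ S` and ascends in all
the other blocks. -/
def IsASPermutation {k : ℕ} (a : Fin k → ℕ) (S : Finset (Fin k))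
    (π : Equiv.Perm (Fin (∑ j, a j))) : Prop :=
  (∀ i ∈ S, StrictAntiOn π (ascDescBlock a i)) ∧
    ∀ i ∉ S, StrictMonoOn π (ascDescBlock a i)

/-- An `(A, S)`-derangement: an `(A, S)`-permutation with no fixed points. -/
def IsASDerangement {k : ℕ} (a : Fin k → ℕ) (S : Finset (Fin k))
    (π : Equiv.Perm (Fin (∑ j, a j))) : Prop :=
  IsASPermutation a S π ∧ π ∈ derangements (Fin (∑ j, a j))

/-- The cycles of `π`, each given by its set of elements; a fixed point is a cycle of length one,
and the length of a cycle is the cardinality of its set of elements. -/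
def permCycles {n : ℕ} (π : Equiv.Perm (Fin n)) : Finset (Finset (Fin n)) :=
  Finset.univ.image fun x => ({y | π.SameCycle x y} : Finset (Fin n))

/-- The small cycles of `π` in the block `A_i`: the cycles all of whose elements lie in `A_i`. -/
def smallCycles {k : ℕ} (a : Fin k → ℕ) (π : Equiv.Perm (Fin (∑ j, a j))) (i : Fin k) :
    Finset (Finset (Fin (∑ j, a j))) :=
  {c ∈ permCycles π | c ⊆ ascDescBlock a i}

open Equiv

/-! Blocks become the fibres of a monotone colouring `c`, and the theorem is strengthened by
imposing the conditions only on colours in a set `T`: the number of permutations obeying the cycle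
constraints for colours in `T` is the product of the factorials of the class sizes times the number
of class-monotone permutations without fixed points of a colour in `T`
(`constrainedCount_eq_mul_ncard_classMonotoneSet`). For empty `T` there is no cycle constraint, and
the claim says that each permutation becomes class-monotone after a unique rearrangement of
positions within classes (`factorial_eq_mul_ncard_classMonotoneSet`). To add a colour `i` to `T`,
both sides are shown to satisfy one recursion, which removes a point of colour `i`. On the monotone
side (`ncard_classMonotoneSet_eq_add`), a permutation excluded by the new condition has a fixed
point of colour `i`; deleting the first one is a bijection onto class-monotone permutations of the
smaller set. A descending class has at most one fixed point, so none of colour `i` remains; in an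
ascending class the rest is unrestricted. On the cycle side (`constrainedCount_univ_succ`), choosing
the points in cycles inside class `i` and permuting them expands each count as a sum over their
number `l`, weighted by falling factorials. Since `(m+1)` falling `l+1` equals `m+1` times `m`
falling `l`, the excluded permutations number `m+1` times a count for the smaller class, where `l`
is allowed iff `l+1` was excluded: "even" stays "even", and "zero" becomes no condition. The factor
`m+1` is the change in the factorial product. -/

/-! ### Points lying in monochromatic cycles -/

/-- The points whose `π`-cycle lies in the colour class `i` of `c`. -/
def innerPart {X ι : Type*} (c : X → ι) (π : Perm X) (i : ι) : Set X :=
  {x | ∀ y, π.SameCycle x y → c y = i}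

/-- The set of permutations for which the number of points in cycles inside the colour class `i`
belongs to `Q i`, for all `i`. -/
def innerConstrained {X ι : Type*} (c : X → ι) (Q : ι → Set ℕ) : Set (Perm X) :=
  {π | ∀ i, (innerPart c π i).ncard ∈ Q i}

theorem sameCycle_permCongr_iff {X Y : Type*} (e : X ≃ Y) (π : Perm X) (x y : X) :
    (e.permCongr π).SameCycle (e x) (e y) ↔ π.SameCycle x y := by
  refine exists_congr fun n => ?_
  have h : (e.permCongr π) ^ n = e.permCongr (π ^ n) := (map_zpow e.permCongrHom π n).symm
  rw [h]
  simp [Equiv.permCongr_apply]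

theorem innerPart_permCongr {X Y ι : Type*} (e : X ≃ Y) (c : X → ι) (d : Y → ι)
    (h : ∀ x, d (e x) = c x) (π : Perm X) (i : ι) :
    innerPart d (e.permCongr π) i = e '' innerPart c π i := by
  ext y
  obtain ⟨x, rfl⟩ := e.surjective y
  rw [e.injective.mem_set_image]
  constructor
  · intro hx z hz
    rw [← h]
    exact hx _ ((sameCycle_permCongr_iff e π x z).2 hz)
  · intro hx z hz
    obtain ⟨z, rfl⟩ := e.surjective z
    rw [h]
    exact hx _ ((sameCycle_permCongr_iff e π x z).1 hz)

theorem ncard_innerConstrained_congr {X Y ι : Type*} (e : X ≃ Y) (c : X → ι) (d : Y → ι)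
    (h : ∀ x, d (e x) = c x) (Q : ι → Set ℕ) :
    (innerConstrained c Q).ncard = (innerConstrained d Q).ncard := by
  refine Set.ncard_congr (fun π _ => e.permCongr π) ?_ ?_ ?_
  · intro π hπ i
    rw [innerPart_permCongr e c d h, Set.ncard_image_of_injective _ e.injective]
    exact hπ i
  · intro π σ _ _ hπσ
    exact e.permCongr.injective hπσ
  · intro σ hσ
    obtain ⟨π, rfl⟩ := e.permCongr.surjective σ
    refine ⟨π, fun i => ?_, rfl⟩
    have := hσ i
    rwa [innerPart_permCongr e c d h, Set.ncard_image_of_injective _ e.injective] at this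

theorem exists_equiv_of_fiber_ncard_eq {X Y ι : Type*} [Finite X] [Finite Y] (c : X → ι)
    (d : Y → ι) (h : ∀ i, {x | c x = i}.ncard = {y | d y = i}.ncard) :
    ∃ e : X ≃ Y, ∀ x, d (e x) = c x := by
  have hf : ∀ i, Nonempty ({x // c x = i} ≃ {y // d y = i}) := fun i =>
    Finite.card_eq.1 (h i)
  let f := fun i => (hf i).some
  refine ⟨(Equiv.sigmaFiberEquiv c).symm.trans
    ((Equiv.sigmaCongrRight f).trans (Equiv.sigmaFiberEquiv d)), fun x => ?_⟩
  exact (f (c x) ⟨x, rfl⟩).2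

theorem apply_mem_innerPart_iff {X ι : Type*} (c : X → ι) (π : Perm X) (i : ι) (x : X) :
    π x ∈ innerPart c π i ↔ x ∈ innerPart c π i := by
  simp only [innerPart, Set.mem_ofPred_eq, Perm.sameCycle_apply_left]

theorem innerPart_subset {X ι : Type*} (c : X → ι) (π : Perm X) (i : ι) :
    innerPart c π i ⊆ {x | c x = i} := fun x hx => hx x (Perm.SameCycle.refl _ _)

theorem mem_of_sameCycle {X : Type*} {π : Perm X} {B : Set X} (hπ : ∀ x, π x ∈ B ↔ x ∈ B)
    {x y : X} (h : π.SameCycle x y) (hx : x ∈ B) : y ∈ B := by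
  obtain ⟨n, rfl⟩ := h
  have := ((π.subtypePerm (p := fun x => x ∈ B) hπ ^ n) ⟨x, hx⟩).2
  simpa [Perm.subtypePerm_zpow] using this

/-! ### Splitting a permutation along an invariant monochromatic set -/

section Split

variable {X ι : Type*} (c : X → ι) (i : ι) (B : Set X)

theorem innerPart_compl_subtypePerm (π : Perm X) (hπ : ∀ x, π x ∉ B ↔ x ∉ B) (j : ι) :
    innerPart (fun x : {x // x ∉ B} => c x) (π.subtypePerm hπ) j =
      Subtype.val ⁻¹' innerPart c π j := by
  ext ⟨x, hx⟩
  constructor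
  · intro h y hy
    have hyB : y ∉ B := mem_of_sameCycle (B := Bᶜ) hπ hy hx
    exact h ⟨y, hyB⟩ (Perm.sameCycle_subtypePerm.2 hy)
  · intro h y hy
    exact h y (Perm.sameCycle_subtypePerm.1 hy)

variable {c i B} [DecidableEq ι]

/-- An invariant `B` inside class `i` is contained in the inner part, so equality means that the
complement has no cycle inside class `i`, which is the constraint `{0}`. Inner parts of other
colours avoid `B` and are unaffected. -/
theorem mem_innerConstrained_compl_iff [Finite X] (hB : B ⊆ {x | c x = i}) (π : Perm X)
    (hπ : ∀ x, π x ∈ B ↔ x ∈ B) (Q : ι → Set ℕ) :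
    π.subtypePerm (fun x => not_congr (hπ x)) ∈
        innerConstrained (fun x : {x // x ∉ B} => c x) (Function.update Q i {0}) ↔
      innerPart c π i = B ∧ ∀ j ≠ i, (innerPart c π j).ncard ∈ Q j := by
  have hBi : B ⊆ innerPart c π i := fun x hx y hy => hB (mem_of_sameCycle hπ hy hx)
  have hi : (innerPart (fun x : {x // x ∉ B} => c x)
      (π.subtypePerm (fun x => not_congr (hπ x))) i).ncard = 0 ↔ innerPart c π i = B := by
    rw [innerPart_compl_subtypePerm, Set.ncard_eq_zero, Set.preimage_eq_empty_iff,
      Subtype.range_coe_subtype]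
    constructor
    · intro h
      refine subset_antisymm (fun x hx => ?_) hBi
      by_contra hxB
      exact Set.disjoint_left.1 h hx hxB
    · intro h
      rw [h]
      exact Set.disjoint_left.2 fun x hx hx' => hx' hx
  have hj : ∀ j ≠ i, (innerPart (fun x : {x // x ∉ B} => c x)
      (π.subtypePerm (fun x => not_congr (hπ x))) j).ncard = (innerPart c π j).ncard := by
    intro j hj
    rw [innerPart_compl_subtypePerm]
    refine Set.ncard_preimage_of_injective_subset_range Subtype.val_injective ?_
    rw [Subtype.range_coe_subtype]
    intro x hx hxB
    exact hj ((innerPart_subset c π j hx).symm.trans (hB hxB))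
  rw [← hi]
  constructor
  · intro h
    refine ⟨by simpa using h i, fun j hji => ?_⟩
    have := h j
    rwa [hj j hji, Function.update_of_ne hji] at this
  · rintro ⟨h1, h2⟩ j
    by_cases hji : j = i
    · subst hji
      simpa using h1
    · rw [hj j hji, Function.update_of_ne hji]
      exact h2 j hji

theorem ncard_innerPart_eq [Finite X] (hB : B ⊆ {x | c x = i}) (Q : ι → Set ℕ) :
    {π : Perm X | innerPart c π i = B ∧ ∀ j ≠ i, (innerPart c π j).ncard ∈ Q j}.ncard =
      B.ncard.factorial *
        (innerConstrained (fun x : {x // x ∉ B} => c x) (Function.update Q i {0})).ncard := by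
  classical
  have hfac : (Set.univ : Set (Perm {x // x ∈ B})).ncard = B.ncard.factorial := by
    rw [Set.ncard_univ, Nat.card_perm]
    rfl
  rw [← hfac, ← Set.ncard_prod]
  symm
  have hpres : ∀ p : Perm {x // x ∈ B} × Perm {x // x ∉ B}, ∀ x,
      Perm.subtypeCongr p.1 p.2 x ∈ B ↔ x ∈ B := by
    intro p x
    by_cases hx : x ∈ B
    · simp [Perm.subtypeCongr.left_apply _ _ hx, hx]
    · simp only [Perm.subtypeCongr.right_apply _ _ hx, hx, iff_false]
      exact (p.2 ⟨x, hx⟩).2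
  have hrestr : ∀ p : Perm {x // x ∈ B} × Perm {x // x ∉ B},
      (Perm.subtypeCongr p.1 p.2).subtypePerm (fun x => not_congr (hpres p x)) = p.2 := by
    intro p
    ext ⟨x, hx⟩
    simp [Perm.subtypeCongr.right_apply _ _ hx]
  refine Set.ncard_congr (fun p _ => Perm.subtypeCongr p.1 p.2) ?_ ?_ ?_
  · rintro p ⟨-, hp⟩
    rw [← hrestr p] at hp
    exact (mem_innerConstrained_compl_iff hB _ (hpres p) Q).1 hp
  · intro p q _ _ hpq
    exact Perm.subtypeCongrHom_injective (fun x => x ∈ B) hpq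
  · intro π h
    have hπ : ∀ x, π x ∈ B ↔ x ∈ B := by
      rw [← h.1]
      exact apply_mem_innerPart_iff c π i
    refine ⟨(π.subtypePerm hπ, π.subtypePerm fun x => not_congr (hπ x)), ⟨trivial, ?_⟩, ?_⟩
    · exact (mem_innerConstrained_compl_iff hB π hπ Q).2 h
    · ext x
      by_cases hx : x ∈ B
      · simp [Perm.subtypeCongr.left_apply _ _ hx]
      · simp [Perm.subtypeCongr.right_apply _ _ hx]

end Split

/-! ### Recursion for the cycle-constrained counts -/

section Recursion

variable {ι : Type*}

/-- The number of permutations of a set with `a j` points of colour `j`, for all `j`, for which the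
number of points in cycles inside the colour class `j` belongs to `Q j`, for all `j`. -/
noncomputable def constrainedCount (a : ι → ℕ) (Q : ι → Set ℕ) : ℕ :=
  (innerConstrained (fun x : Σ j, Fin (a j) => x.1) Q).ncard

theorem ncard_sigma_fiber (a : ι → ℕ) (i : ι) :
    {x : Σ j, Fin (a j) | x.1 = i}.ncard = a i := by
  have : {x : Σ j, Fin (a j) | x.1 = i} = Sigma.mk i '' Set.univ := by
    ext ⟨j, y⟩
    constructor
    · rintro rfl
      exact ⟨y, trivial, rfl⟩
    · rintro ⟨z, -, hz⟩
      exact (congrArg Sigma.fst hz).symm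
  rw [this, Set.ncard_image_of_injective _ sigma_mk_injective, Set.ncard_univ, Nat.card_fin]

theorem ncard_innerConstrained [Finite ι] {X : Type*} [Finite X] (c : X → ι) (Q : ι → Set ℕ) :
    (innerConstrained c Q).ncard = constrainedCount (fun i => {x | c x = i}.ncard) Q := by
  obtain ⟨e, he⟩ := exists_equiv_of_fiber_ncard_eq c
    (fun x : Σ j, Fin ({x | c x = j}.ncard) => x.1) fun i =>
      (ncard_sigma_fiber (fun j => {x | c x = j}.ncard) i).symm
  exact ncard_innerConstrained_congr e _ _ he Q

theorem constrainedCount_univ [Fintype ι] (a : ι → ℕ) :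
    constrainedCount a (fun _ => Set.univ) = (∑ i, a i).factorial := by
  have : innerConstrained (fun x : Σ j, Fin (a j) => x.1) (fun _ => Set.univ) = Set.univ :=
    Set.eq_univ_of_forall fun _ _ => Set.mem_univ _
  rw [constrainedCount, this, Set.ncard_univ, Nat.card_perm, Nat.card_sigma]
  simp

variable [DecidableEq ι]

/-- Permutations are sorted by their inner part `B` of colour `i`. Each `B` of size `l` contributes
`l!` times a count on the complement, and the number of such `B` turns `l!` into a falling
factorial. -/
theorem ncard_innerConstrained_eq_sum [Finite ι] {X : Type*} [Fintype X] (c : X → ι) (i : ι)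
    (Q : ι → Set ℕ) [DecidablePred (· ∈ Q i)] :
    (innerConstrained c Q).ncard =
      ∑ l ∈ Finset.range ({x | c x = i}.ncard + 1), if l ∈ Q i then
        {x | c x = i}.ncard.descFactorial l * constrainedCount
          (Function.update (fun j => {x | c x = j}.ncard) i ({x | c x = i}.ncard - l))
          (Function.update Q i {0}) else 0 := by
  classical
  set F : Finset X := Finset.univ.filter fun x => c x = i with hF
  have hFc : {x | c x = i}.ncard = F.card := by
    rw [← Set.ncard_coe_finset, hF]
    simp
  have hmaps : ∀ π ∈ (innerConstrained c Q).toFinset, (innerPart c π i).toFinset ∈ F.powerset := by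
    intro π _
    rw [Finset.mem_powerset]
    intro x hx
    simpa [hF] using innerPart_subset c π i (by simpa using hx)
  have hterm : ∀ B ∈ F.powerset,
      ((innerConstrained c Q).toFinset.filter fun π => (innerPart c π i).toFinset = B).card =
        if B.card ∈ Q i then B.card.factorial * constrainedCount
          (Function.update (fun j => {x | c x = j}.ncard) i ({x | c x = i}.ncard - B.card))
          (Function.update Q i {0}) else 0 := by
    intro B hB
    rw [Finset.mem_powerset] at hB
    have hB' : (B : Set X) ⊆ {x | c x = i} := fun x hx => by simpa [hF] using hB hx
    split_ifs with hQ
    · rw [← Set.ncard_coe_finset]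
      have hset : (((innerConstrained c Q).toFinset.filter
          fun π => (innerPart c π i).toFinset = B : Finset (Perm X)) : Set (Perm X)) =
          {π | innerPart c π i = B ∧ ∀ j ≠ i, (innerPart c π j).ncard ∈ Q j} := by
        ext π
        have h1 : (innerPart c π i).toFinset = B ↔ innerPart c π i = B := by
          rw [← Finset.coe_inj, Set.coe_toFinset]
        simp only [Finset.coe_filter, Set.mem_toFinset, Set.mem_ofPred_eq, h1]
        constructor
        · rintro ⟨h, h'⟩
          exact ⟨h', fun j _ => h j⟩
        · rintro ⟨h, h'⟩
          refine ⟨fun j => ?_, h⟩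
          by_cases hj : j = i
          · subst hj
            rw [h, Set.ncard_coe_finset]
            exact hQ
          · exact h' j hj
      rw [hset, ncard_innerPart_eq hB' Q, Set.ncard_coe_finset, ncard_innerConstrained]
      congr 2
      funext j
      have hpre : {x : {x // x ∉ (B : Set X)} | c x = j} = Subtype.val ⁻¹' ({x | c x = j} \ B) := by
        ext ⟨x, hx⟩
        simpa using fun _ => hx
      rw [hpre, Set.ncard_preimage_of_injective_subset_range Subtype.val_injective
        (by rw [Subtype.range_coe_subtype]; exact fun x hx => hx.2)]
      by_cases hj : j = i
      · subst hj
        rw [Function.update_self, Set.ncard_sdiff hB', Set.ncard_coe_finset]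
      · rw [Function.update_of_ne hj, sdiff_eq_left.2]
        exact Set.disjoint_left.2 fun x hx hxB => hj (hx.symm.trans (hB' hxB))
    · rw [Finset.card_eq_zero, Finset.filter_eq_empty_iff]
      rintro π hπ rfl
      refine hQ ?_
      rw [← Set.ncard_eq_toFinset_card']
      exact (Set.mem_toFinset.1 hπ) i
  rw [Set.ncard_eq_toFinset_card', Finset.card_eq_sum_card_fiberwise hmaps,
    Finset.sum_congr rfl hterm, Finset.sum_powerset_apply_card fun l => if l ∈ Q i then
      l.factorial * constrainedCount
          (Function.update (fun j => {x | c x = j}.ncard) i ({x | c x = i}.ncard - l))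
          (Function.update Q i {0}) else 0, hFc]
  refine Finset.sum_congr rfl fun l _ => ?_
  split_ifs
  · rw [Nat.descFactorial_eq_factorial_mul_choose, smul_eq_mul]
    ring
  · simp

theorem constrainedCount_update_eq_sum [Fintype ι] (a : ι → ℕ) (i : ι) (m : ℕ) (Q : ι → Set ℕ)
    (P : Set ℕ) [DecidablePred (· ∈ P)] :
    constrainedCount (Function.update a i m) (Function.update Q i P) =
      ∑ l ∈ Finset.range (m + 1), if l ∈ P then
        m.descFactorial l *
          constrainedCount (Function.update a i (m - l)) (Function.update Q i {0}) else 0 := by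
  classical
  conv_lhs => rw [constrainedCount]
  rw [ncard_innerConstrained_eq_sum _ i]
  simp only [ncard_sigma_fiber, Function.update_self, Function.update_idem]

theorem constrainedCount_univ_succ [Fintype ι] (a : ι → ℕ) (i : ι) (m : ℕ) (Q : ι → Set ℕ)
    (P : Set ℕ) (hP : 0 ∈ P) :
    constrainedCount (Function.update a i (m + 1)) (Function.update Q i Set.univ) =
      constrainedCount (Function.update a i (m + 1)) (Function.update Q i P) +
        (m + 1) * constrainedCount (Function.update a i m)
          (Function.update Q i {l | l + 1 ∉ P}) := by
  classical
  rw [constrainedCount_update_eq_sum a i (m + 1) Q Set.univ,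
    constrainedCount_update_eq_sum a i (m + 1) Q P,
    constrainedCount_update_eq_sum a i m Q {l | l + 1 ∉ P}]
  -- The term `l = 0` occurs on both sides because `0 ∈ P`; every other index `l + 1` is counted
  -- either by `P` or by the shifted complement.
  rw [Finset.sum_range_succ', Finset.sum_range_succ' _ (m + 1), Finset.mul_sum, add_right_comm,
    ← Finset.sum_add_distrib]
  congr 1
  · refine Finset.sum_congr rfl fun l _ => ?_
    rw [Nat.succ_descFactorial_succ, Nat.add_sub_add_right]
    by_cases h : l + 1 ∈ P <;> simp [h, mul_assoc]
  · simp [hP]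

theorem constrainedCount_univ_zero [Fintype ι] (a : ι → ℕ) (i : ι) (Q : ι → Set ℕ)
    (P : Set ℕ) (hP : 0 ∈ P) :
    constrainedCount (Function.update a i 0) (Function.update Q i Set.univ) =
      constrainedCount (Function.update a i 0) (Function.update Q i P) := by
  classical
  rw [constrainedCount_update_eq_sum a i 0 Q Set.univ, constrainedCount_update_eq_sum a i 0 Q P]
  simp [hP]

end Recursion

/-! ### Inserting and deleting a fixed point -/

/-- The permutation of `Fin (n + 1)` obtained from `τ` by inserting `p` as a fixed point. -/
def insertFixed {n : ℕ} (p : Fin (n + 1)) (τ : Perm (Fin n)) : Perm (Fin (n + 1)) :=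
  (finSuccEquiv' p).trans ((optionCongr τ).trans (finSuccEquiv' p).symm)

theorem insertFixed_self {n : ℕ} (p : Fin (n + 1)) (τ : Perm (Fin n)) :
    insertFixed p τ p = p := by
  simp [insertFixed]

theorem insertFixed_succAbove {n : ℕ} (p : Fin (n + 1)) (τ : Perm (Fin n)) (y : Fin n) :
    insertFixed p τ (p.succAbove y) = p.succAbove (τ y) := by
  simp [insertFixed]

theorem insertFixed_injective {n : ℕ} (p : Fin (n + 1)) :
    Function.Injective (insertFixed p) := by
  intro τ σ h
  ext y : 1
  have := congrArg (fun π => π (p.succAbove y)) h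
  simpa [insertFixed_succAbove] using this

theorem exists_insertFixed_eq {n : ℕ} {p : Fin (n + 1)} {π : Perm (Fin (n + 1))} (h : π p = p) :
    ∃ τ, insertFixed p τ = π := by
  refine ⟨removeNone ((finSuccEquiv' p).symm.trans (π.trans (finSuccEquiv' p))), ?_⟩
  set e : Option (Fin n) ≃ Option (Fin n) :=
    (finSuccEquiv' p).symm.trans (π.trans (finSuccEquiv' p)) with he
  have hnone : e none = none := by simp [he, h]
  ext x : 1
  obtain rfl | ⟨y, rfl⟩ := Fin.eq_self_or_eq_succAbove p x
  · rw [insertFixed_self, h]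
  · rw [insertFixed_succAbove]
    apply (finSuccEquiv' p).injective
    rw [finSuccEquiv'_succAbove]
    have hy : ∃ z, e (some y) = some z := by
      rw [← Option.ne_none_iff_exists']
      intro h'
      exact absurd (e.injective (h'.trans hnone.symm)) (by simp)
    rw [removeNone_some e hy]
    simp [he]

/-! ### Where a fixed point can be inserted into a monotone class -/

section Monotone

variable {ι : Type*} [LinearOrder ι]

theorem Monotone.eq_of_between {α : Type*} [Preorder α] {c : α → ι} (hc : Monotone c)
    {x y z : α} {i : ι} (hxy : x ≤ y) (hyz : y ≤ z) (hx : c x = i) (hz : c z = i) : c y = i :=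
  le_antisymm ((hc hyz).trans hz.le) (hx.ge.trans (hc hxy))

/-- Colour classes are intervals, so the colouring left after deleting a point depends only on the
colour of that point. -/
theorem Monotone.comp_succAbove_eq {n : ℕ} {c : Fin (n + 1) → ι} (hc : Monotone c)
    {p q : Fin (n + 1)} (h : c p = c q) : c ∘ p.succAbove = c ∘ q.succAbove := by
  wlog hpq : p ≤ q generalizing p q
  · exact (this h.symm (le_of_not_ge hpq)).symm
  funext y
  simp only [Function.comp]
  by_cases h1 : y.castSucc < p
  · rw [Fin.succAbove_of_castSucc_lt _ _ h1, Fin.succAbove_of_castSucc_lt _ _ (h1.trans_le hpq)]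
  by_cases h2 : y.castSucc < q
  · rw [Fin.succAbove_of_le_castSucc _ _ (not_lt.1 h1), Fin.succAbove_of_castSucc_lt _ _ h2,
      hc.eq_of_between (i := c q) ((not_lt.1 h1).trans (Fin.castSucc_lt_succ).le)
        (Fin.castSucc_lt_iff_succ_le.1 h2) h rfl,
      hc.eq_of_between (i := c q) (not_lt.1 h1) h2.le h rfl]
  · rw [Fin.succAbove_of_le_castSucc _ _ (not_lt.1 h1),
      Fin.succAbove_of_le_castSucc _ _ (not_lt.1 h2)]

/-- A predicate that is decreasing along a colour class switches from true to false at exactly one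
position. -/
theorem existsUnique_switch {ι : Type*} {n : ℕ} {c : Fin (n + 1) → ι} {c' : Fin n → ι}
    {i : ι} (hc' : ∀ p, c p = i → c ∘ p.succAbove = c') (hi : ∃ p, c p = i) (L : Fin n → Prop)
    (hL : ∀ y z, c' y = i → c' z = i → y < z → L z → L y) :
    ∃! p, c p = i ∧ ∀ y, c' y = i → (y.castSucc < p ↔ L y) := by
  classical
  have hc'' : ∀ p, c p = i → ∀ y, c (p.succAbove y) = c' y := fun p hp y => congrFun (hc' p hp) y
  set A : Finset (Fin (n + 1)) :=
    Finset.univ.filter fun p => c p = i ∧ ∀ y, c' y = i → p ≤ y.castSucc → ¬ L y with hA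
  have hne : A.Nonempty := by
    -- The last position of colour `i` qualifies vacuously: a `y` of colour `i` at or after it would
    -- make `y.succ` a later position of that colour.
    set B : Finset (Fin (n + 1)) := Finset.univ.filter fun p => c p = i with hB
    have hBne : B.Nonempty := by
      obtain ⟨p, hp⟩ := hi
      exact ⟨p, by simpa [hB] using hp⟩
    have hmax : c (B.max' hBne) = i := by simpa [hB] using B.max'_mem hBne
    refine ⟨B.max' hBne, ?_⟩
    simp only [hA, Finset.mem_filter, Finset.mem_univ, true_and]
    refine ⟨hmax, fun y hy hle => ?_⟩
    have h1 := hc'' _ hmax y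
    rw [Fin.succAbove_of_le_castSucc _ _ hle, hy] at h1
    have h2 := B.le_max' y.succ (by simpa [hB] using h1)
    exact absurd (h2.trans hle) (not_le.2 Fin.castSucc_lt_succ)
  refine existsUnique_of_exists_of_unique ⟨A.min' hne, ?_⟩ ?_
  · have hmem := A.min'_mem hne
    set p := A.min' hne with hp
    simp only [hA, Finset.mem_filter, Finset.mem_univ, true_and] at hmem
    refine ⟨hmem.1, fun y hy => ⟨fun hlt => ?_, fun hLy => ?_⟩⟩
    · by_contra hLy
      have h1 := hc'' _ hmem.1 y
      rw [Fin.succAbove_of_castSucc_lt _ _ hlt, hy] at h1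
      have h2 : y.castSucc ∈ A := by
        simp only [hA, Finset.mem_filter, Finset.mem_univ, true_and]
        refine ⟨h1, fun z hz hyz hLz => hLy ?_⟩
        obtain rfl | hlt' := (Fin.castSucc_le_castSucc_iff.1 hyz).eq_or_lt
        · exact hLz
        · exact hL y z hy hz hlt' hLz
      exact absurd hlt (not_lt.2 (A.min'_le _ h2))
    · by_contra h
      exact hmem.2 y hy (not_lt.1 h) hLy
  · have key : ∀ p q, (c p = i ∧ ∀ y, c' y = i → (y.castSucc < p ↔ L y)) →
        (c q = i ∧ ∀ y, c' y = i → (y.castSucc < q ↔ L y)) → ¬ p < q := by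
      rintro p q ⟨hp, hp'⟩ ⟨hq, hq'⟩ hpq
      -- Of two candidate positions, the smaller one, read as an index `y` of the reduced set, is
      -- before `q` but not before itself, so `L y` would be both true and false.
      obtain ⟨y, rfl⟩ := Fin.exists_castSucc_eq.2 (ne_of_lt (hpq.trans_le (Fin.le_last q)))
      have hy : c' y = i := by
        rw [← hc'' q hq, Fin.succAbove_of_castSucc_lt _ _ hpq, hp]
      exact lt_irrefl _ ((hp' y hy).2 ((hq' y hy).1 hpq))
    intro p q hp hq
    exact le_antisymm (not_lt.1 (key q p hq hp)) (not_lt.1 (key p q hp hq))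

variable {n : ℕ} {S T : Finset ι}

/-- Within each colour class of `c`, the permutation `π` is decreasing if the colour is in `S`, and
increasing otherwise. -/
def IsClassMonotone (c : Fin n → ι) (S : Finset ι) (π : Perm (Fin n)) : Prop :=
  ∀ x y, x < y → c x = c y → (c x ∈ S → π y < π x) ∧ (c x ∉ S → π x < π y)

/-- The permutations monotone on the colour classes of `c` in the directions given by `S`, without
fixed points of a colour in `T`. -/
def classMonotoneSet (c : Fin n → ι) (S T : Finset ι) : Set (Perm (Fin n)) :=
  {π | IsClassMonotone c S π ∧ ∀ x, c x ∈ T → π x ≠ x}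

/-- A strictly increasing integer-valued map gains at least one per step, so the displacement `τ y -
y` is weakly increasing along an ascending class. -/
theorem IsClassMonotone.add_le_add {c : Fin n → ι} (hc : Monotone c) {τ : Perm (Fin n)}
    (hτ : IsClassMonotone c S τ) {i : ι} (hi : i ∉ S) {y z : Fin n} (hy : c y = i) (hz : c z = i)
    (hyz : y ≤ z) : (τ y : ℕ) + z ≤ τ z + y := by
  obtain ⟨d, hd⟩ := Nat.exists_eq_add_of_le (Fin.le_def.1 hyz)
  induction d generalizing z with
  | zero =>
    obtain rfl : z = y := Fin.ext hd
    exact le_rfl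
  | succ d ih =>
    have hw : (z : ℕ) - 1 < n := by omega
    have hwz : (⟨z - 1, hw⟩ : Fin n) < z := by rw [Fin.lt_def]; simp only; omega
    have hyw : y ≤ ⟨z - 1, hw⟩ := by rw [Fin.le_def]; simp only; omega
    have hcw := hc.eq_of_between hyw hwz.le hy hz
    have h1 := ih hcw hyw (by simp only; omega)
    have h2 := Fin.lt_def.1 ((hτ _ z hwz (hcw.trans hz.symm)).2 (hcw ▸ hi))
    simp only at h1
    omega

/-- The class-monotone permutation `τ` moves the point `y` of colour `i` in the direction of the
beginning of an increasing class, or of the end of a decreasing class. -/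
def MovesEarly (S : Finset ι) (i : ι) (τ : Perm (Fin n)) (y : Fin n) : Prop :=
  (i ∈ S ∧ y < τ y) ∨ (i ∉ S ∧ τ y < y)

theorem MovesEarly.apply_ne {ι : Type*} {S : Finset ι} {i : ι} {τ : Perm (Fin n)} {y : Fin n} (h : MovesEarly S i τ y) :
    τ y ≠ y := by
  rcases h with ⟨-, h⟩ | ⟨-, h⟩
  · exact h.ne'
  · exact h.ne

/-- This makes `MovesEarly` an initial segment of the class: displacement is weakly increasing in an
ascending class, while in a descending one `y < z < τ z < τ y`. -/
theorem MovesEarly.of_lt {c : Fin n → ι} (hc : Monotone c) {τ : Perm (Fin n)}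
    (hτ : IsClassMonotone c S τ) {i : ι} {y z : Fin n} (hy : c y = i) (hz : c z = i)
    (hyz : y < z) (h : MovesEarly S i τ z) : MovesEarly S i τ y := by
  rcases h with ⟨hi, h⟩ | ⟨hi, h⟩
  · exact .inl ⟨hi, hyz.trans (h.trans ((hτ y z hyz (hy.trans hz.symm)).1 (hy ▸ hi)))⟩
  · refine .inr ⟨hi, ?_⟩
    have := hτ.add_le_add hc hi hy hz hyz.le
    rw [Fin.lt_def] at h ⊢
    omega

theorem isClassMonotone_insertFixed_iff {ι : Type*} {S : Finset ι} {c : Fin (n + 1) → ι} {i : ι} {p : Fin (n + 1)}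
    (hp : c p = i) {τ : Perm (Fin n)} :
    IsClassMonotone c S (insertFixed p τ) ↔ IsClassMonotone (c ∘ p.succAbove) S τ ∧
      ∀ y, c (p.succAbove y) = i →
        ((i ∈ S → (y.castSucc < p ↔ p ≤ (τ y).castSucc)) ∧
          (i ∉ S → (y.castSucc < p ↔ (τ y).castSucc < p))) := by
  constructor
  · refine fun h => ⟨fun x y hxy hcxy => ?_, fun y hy => ?_⟩
    · have := h (p.succAbove x) (p.succAbove y) (Fin.succAbove_lt_succAbove_iff.2 hxy) hcxy
      simpa only [insertFixed_succAbove, Fin.succAbove_lt_succAbove_iff, Function.comp_apply]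
        using this
    · by_cases hlt : y.castSucc < p
      · have := h _ p ((Fin.succAbove_lt_iff_castSucc_lt p y).2 hlt) (hy.trans hp.symm)
        simpa only [insertFixed_succAbove, insertFixed_self, hy, Fin.succAbove_lt_iff_castSucc_lt,
          Fin.lt_succAbove_iff_le_castSucc, hlt, true_iff] using this
      · have := h p _ ((Fin.lt_succAbove_iff_le_castSucc p y).2 (not_lt.1 hlt)) (hp.trans hy.symm)
        simpa only [insertFixed_succAbove, insertFixed_self, hp, Fin.succAbove_lt_iff_castSucc_lt,
          Fin.lt_succAbove_iff_le_castSucc, hlt, false_iff, not_lt, not_le] using this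
  · rintro ⟨h1, h2⟩ x y hxy hcxy
    obtain rfl | ⟨x, rfl⟩ := Fin.eq_self_or_eq_succAbove p x
    · obtain rfl | ⟨y, rfl⟩ := Fin.eq_self_or_eq_succAbove x y
      · exact absurd hxy (lt_irrefl _)
      · have h3 := h2 y (hcxy.symm.trans hp)
        have h4 := not_lt.2 ((Fin.lt_succAbove_iff_le_castSucc _ _).1 hxy)
        simpa only [insertFixed_succAbove, insertFixed_self, hp, Fin.succAbove_lt_iff_castSucc_lt,
          Fin.lt_succAbove_iff_le_castSucc, h4, false_iff, not_lt, not_le] using h3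
    · obtain rfl | ⟨y, rfl⟩ := Fin.eq_self_or_eq_succAbove p y
      · have h3 := h2 x (hcxy.trans hp)
        have h4 := (Fin.succAbove_lt_iff_castSucc_lt _ _).1 hxy
        simpa only [insertFixed_succAbove, insertFixed_self, hcxy.trans hp,
          Fin.succAbove_lt_iff_castSucc_lt, Fin.lt_succAbove_iff_le_castSucc, h4, true_iff] using h3
      · have := h1 x y (Fin.succAbove_lt_succAbove_iff.1 hxy) hcxy
        simpa only [insertFixed_succAbove, Fin.succAbove_lt_succAbove_iff, Function.comp_apply]
        using this

/-- For a permutation `τ` and a position `p` inside an increasing class, `τ` preserves the part of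
the class before `p` without fixing any of its points iff `p` is the switching position of
`MovesEarly`. -/
theorem switch_iff_of_notMem {c : Fin (n + 1) → ι} (hc : Monotone c) {i : ι} (hi : i ∉ S)
    {p : Fin (n + 1)} (hp : c p = i) {τ : Perm (Fin n)}
    (hτ : IsClassMonotone (c ∘ p.succAbove) S τ) :
    (∀ y, c (p.succAbove y) = i → (y.castSucc < p ↔ MovesEarly S i τ y)) ↔
      ∀ y, c (p.succAbove y) = i → (y.castSucc < p ↔ (τ y).castSucc < p) ∧
        (y.castSucc < p → τ y ≠ y) := by
  have hc' : Monotone (c ∘ p.succAbove) := hc.comp (Fin.strictMono_succAbove p).monotone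
  simp only [MovesEarly, hi, false_and, false_or, not_false_eq_true, true_and]
  constructor
  · refine fun h y hy => ⟨?_, fun hyp => ((h y hy).1 hyp).ne⟩
    have := h y hy
    simp only [Fin.lt_def, Fin.val_castSucc] at this ⊢
    omega
  · refine fun h y hy => ⟨fun hyp => ?_, fun hyp => ?_⟩
    · refine lt_of_le_of_ne ?_ ((h y hy).2 hyp)
      rw [Fin.lt_def, Fin.val_castSucc] at hyp
      -- It suffices to test the last point before `p`: its displacement is at most zero, hence so
      -- is that of every earlier point of the class.
      have hz : (p : ℕ) - 1 < n := by omega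
      have hzp : (⟨p - 1, hz⟩ : Fin n).castSucc < p := by
        rw [Fin.lt_def]
        simp only [Fin.val_castSucc]
        omega
      have hyz : y ≤ ⟨p - 1, hz⟩ := by rw [Fin.le_def]; simp only; omega
      have hcz : c (p.succAbove ⟨p - 1, hz⟩) = i :=
        hc.eq_of_between ((Fin.strictMono_succAbove p).monotone hyz)
          ((Fin.succAbove_lt_iff_castSucc_lt _ _).2 hzp).le hy hp
      have h1 := ((h _ hcz).1).1 hzp
      have h2 := hτ.add_le_add hc' hi hy hcz hyz
      simp only [Fin.lt_def, Fin.val_castSucc, Fin.le_def] at *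
      omega
    · by_contra hyp'
      have hpy := hyp'
      rw [Fin.lt_def, Fin.val_castSucc] at hpy
      have hz : (p : ℕ) < n := by omega
      have hzp : ¬ (⟨p, hz⟩ : Fin n).castSucc < p := by simp
      have hzy : (⟨p, hz⟩ : Fin n) ≤ y := by rw [Fin.le_def]; simp only; omega
      have hcz : c (p.succAbove ⟨p, hz⟩) = i :=
        hc.eq_of_between ((Fin.lt_succAbove_iff_le_castSucc _ _).2 (not_lt.1 hzp)).le
          ((Fin.strictMono_succAbove p).monotone hzy) hp hy
      have h1 := mt ((h _ hcz).1).2 hzp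
      have h2 := hτ.add_le_add hc' hi hcz hy hzy
      simp only [Fin.lt_def, Fin.val_castSucc, Fin.le_def] at *
      omega

theorem switch_iff_of_mem {c : Fin (n + 1) → ι} (hc : Monotone c) {i : ι} (hi : i ∈ S)
    {p : Fin (n + 1)} (hp : c p = i) {τ : Perm (Fin n)}
    (hτ : IsClassMonotone (c ∘ p.succAbove) S τ) :
    ((∀ y, c (p.succAbove y) = i → (y.castSucc < p ↔ MovesEarly S i τ y)) ∧
        ∀ y, c (p.succAbove y) = i → τ y ≠ y) ↔
      ∀ y, c (p.succAbove y) = i → (y.castSucc < p ↔ p ≤ (τ y).castSucc) := by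
  simp only [MovesEarly, hi, not_true_eq_false, false_and, or_false, true_and]
  constructor
  · rintro ⟨h, hfix⟩ y hy
    constructor
    · intro hyp
      rw [Fin.lt_def, Fin.val_castSucc] at hyp
      have hz : (p : ℕ) - 1 < n := by omega
      have hzp : (⟨p - 1, hz⟩ : Fin n).castSucc < p := by
        rw [Fin.lt_def]
        simp only [Fin.val_castSucc]
        omega
      have hyz : y ≤ ⟨p - 1, hz⟩ := by rw [Fin.le_def]; simp only; omega
      have hcz : c (p.succAbove ⟨p - 1, hz⟩) = i :=
        hc.eq_of_between ((Fin.strictMono_succAbove p).monotone hyz)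
          ((Fin.succAbove_lt_iff_castSucc_lt _ _).2 hzp).le hy hp
      have h1 := (h _ hcz).1 hzp
      have h2 : τ ⟨p - 1, hz⟩ ≤ τ y := by
        rcases hyz.eq_or_lt with rfl | hlt
        · exact le_rfl
        · exact ((hτ _ _ hlt (hy.trans hcz.symm)).1 (by simpa [hy] using hi)).le
      simp only [Fin.lt_def, Fin.val_castSucc, Fin.le_def] at *
      omega
    · intro hle
      by_contra hyp'
      have hpy := hyp'
      rw [Fin.lt_def, Fin.val_castSucc] at hpy
      -- The index `p` is the first point after the gap. It is not moved up and not fixed, so its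
      -- image lies before the gap, as do those of all later points of the class.
      have hz : (p : ℕ) < n := by omega
      have hzp : ¬ (⟨p, hz⟩ : Fin n).castSucc < p := by simp
      have hzy : (⟨p, hz⟩ : Fin n) ≤ y := by rw [Fin.le_def]; simp only; omega
      have hcz : c (p.succAbove ⟨p, hz⟩) = i :=
        hc.eq_of_between ((Fin.lt_succAbove_iff_le_castSucc _ _).2 (not_lt.1 hzp)).le
          ((Fin.strictMono_succAbove p).monotone hzy) hp hy
      have h1 := lt_of_le_of_ne (not_lt.1 (mt (h _ hcz).2 hzp)) (hfix _ hcz)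
      have h2 : τ y ≤ τ ⟨p, hz⟩ := by
        rcases hzy.eq_or_lt with rfl | hlt
        · exact le_rfl
        · exact ((hτ _ _ hlt (hcz.trans hy.symm)).1 (by simpa [hcz] using hi)).le
      simp only [Fin.lt_def, Fin.val_castSucc, Fin.le_def] at *
      omega
  · intro h
    refine ⟨fun y hy => ?_, fun y hy hfix => ?_⟩ <;> have := h y hy
    · simp only [Fin.lt_def, Fin.val_castSucc, Fin.le_def] at *
      omega
    · rw [hfix] at this
      exact absurd this (by rw [← not_le]; tauto)

end Monotone

/-! ### Recursion for class-monotone permutations -/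

section Recursion

variable {ι : Type*} [LinearOrder ι] {n : ℕ} {S T : Finset ι}

/-- Minimality of the fixed point is demanded only for ascending classes, since a descending class
has at most one; that uniqueness also puts `i` into the forbidden colours for `τ`. -/
theorem insertFixed_mem_classMonotoneSet_iff {c : Fin (n + 1) → ι} (hc : Monotone c) {i : ι}
    (hiT : i ∉ T) {p : Fin (n + 1)} (hp : c p = i) (τ : Perm (Fin n)) :
    (insertFixed p τ ∈ classMonotoneSet c S T ∧
        (i ∉ S → ∀ q < p, c q = i → insertFixed p τ q ≠ q)) ↔
      τ ∈ classMonotoneSet (c ∘ p.succAbove) S (if i ∈ S then insert i T else T) ∧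
        ∀ y, c (p.succAbove y) = i → (y.castSucc < p ↔ MovesEarly S i τ y) := by
  have hT : (∀ x, c x ∈ T → insertFixed p τ x ≠ x) ↔ ∀ y, c (p.succAbove y) ∈ T → τ y ≠ y := by
    constructor
    · intro h y hy hfix
      exact h _ hy (by rw [insertFixed_succAbove, hfix])
    · intro h x hx hfix
      obtain rfl | ⟨y, rfl⟩ := Fin.eq_self_or_eq_succAbove p x
      · exact hiT (hp ▸ hx)
      · rw [insertFixed_succAbove, Fin.succAbove_right_inj] at hfix
        exact h y hx hfix
  have hfirst : (∀ q < p, c q = i → insertFixed p τ q ≠ q) ↔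
      ∀ y, c (p.succAbove y) = i → y.castSucc < p → τ y ≠ y := by
    constructor
    · intro h y hy hlt hfix
      exact h _ ((Fin.succAbove_lt_iff_castSucc_lt p y).2 hlt) hy
        (by rw [insertFixed_succAbove, hfix])
    · intro h q hq hcq hfix
      obtain rfl | ⟨y, rfl⟩ := Fin.eq_self_or_eq_succAbove p q
      · exact lt_irrefl _ hq
      · rw [insertFixed_succAbove, Fin.succAbove_right_inj] at hfix
        exact h y hcq ((Fin.succAbove_lt_iff_castSucc_lt p y).1 hq) hfix
  simp only [classMonotoneSet, Set.mem_ofPred_eq, isClassMonotone_insertFixed_iff hp, hT, hfirst]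
  by_cases hi : i ∈ S
  · simp only [hi, if_true, Finset.mem_insert, not_true_eq_false, false_imp_iff, and_true,
      true_imp_iff, Function.comp_apply]
    constructor
    · rintro ⟨⟨h1, h2⟩, h3⟩
      have h4 := (switch_iff_of_mem hc hi hp h1).2 h2
      refine ⟨⟨h1, fun y hy => ?_⟩, h4.1⟩
      exact hy.elim (h4.2 y) (h3 y)
    · rintro ⟨⟨h1, h2⟩, h3⟩
      exact ⟨⟨h1, (switch_iff_of_mem hc hi hp h1).1 ⟨h3, fun y hy => h2 y (.inl hy)⟩⟩,
        fun y hy => h2 y (.inr hy)⟩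
  · simp only [hi, if_false, not_false_eq_true, false_imp_iff, true_and, true_imp_iff,
      Function.comp_apply]
    constructor
    · rintro ⟨⟨⟨h1, h2⟩, h3⟩, h4⟩
      exact ⟨⟨h1, h3⟩, (switch_iff_of_notMem hc hi hp h1).2 fun y hy => ⟨h2 y hy, h4 y hy⟩⟩
    · rintro ⟨⟨h1, h2⟩, h3⟩
      have h4 := (switch_iff_of_notMem hc hi hp h1).1 h3
      exact ⟨⟨⟨h1, fun y hy => (h4 y hy).1⟩, h2⟩, fun y hy => (h4 y hy).2⟩

theorem ncard_classMonotoneSet_eq_add {c : Fin (n + 1) → ι} (hc : Monotone c) {i : ι}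
    (hiT : i ∉ T) {p : Fin (n + 1)} (hp : c p = i) :
    (classMonotoneSet c S T).ncard = (classMonotoneSet c S (insert i T)).ncard +
      (classMonotoneSet (c ∘ p.succAbove) S (if i ∈ S then insert i T else T)).ncard := by
  classical
  set c' := c ∘ p.succAbove with hc'
  have hcc : ∀ q, c q = i → c ∘ q.succAbove = c' := fun q hq =>
    hc.comp_succAbove_eq (hq.trans hp.symm)
  have hcc' : ∀ q, c q = i → ∀ y, c (q.succAbove y) = c' y := fun q hq y => congrFun (hcc q hq) y
  have hc'm : Monotone c' := hc.comp (Fin.strictMono_succAbove p).monotone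
  have hsub : classMonotoneSet c S (insert i T) ⊆ classMonotoneSet c S T := fun π hπ =>
    ⟨hπ.1, fun x hx => hπ.2 x (Finset.mem_insert_of_mem hx)⟩
  rw [← Set.ncard_sdiff_add_ncard_of_subset hsub, add_comm]
  congr 1
  symm
  have hpos : ∀ τ ∈ classMonotoneSet c' S (if i ∈ S then insert i T else T),
      ∃! q, c q = i ∧ ∀ y, c' y = i → (y.castSucc < q ↔ MovesEarly S i τ y) := fun τ hτ =>
    existsUnique_switch hcc ⟨p, hp⟩ _ fun y z hy hz hyz => MovesEarly.of_lt hc'm hτ.1 hy hz hyz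
  choose! pos hpos huniq using hpos
  have hins : ∀ τ ∈ classMonotoneSet c' S (if i ∈ S then insert i T else T),
      insertFixed (pos τ) τ ∈ classMonotoneSet c S T := by
    intro τ hτ
    obtain ⟨h1, h2⟩ := hpos τ hτ
    refine ((insertFixed_mem_classMonotoneSet_iff hc hiT h1 τ).2 ⟨?_, fun y hy => ?_⟩).1
    · rwa [hcc _ h1]
    · exact h2 y (by rwa [← hcc' _ h1])
  refine Set.ncard_congr (fun τ _ => insertFixed (pos τ) τ) ?_ ?_ ?_
  · intro τ hτ
    refine ⟨hins τ hτ, fun h => ?_⟩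
    exact h.2 (pos τ) (by rw [(hpos τ hτ).1]; exact Finset.mem_insert_self _ _)
      (insertFixed_self _ _)
  · have hnlt : ∀ τ ∈ classMonotoneSet c' S (if i ∈ S then insert i T else T), ∀ σ,
        σ ∈ classMonotoneSet c' S (if i ∈ S then insert i T else T) →
        insertFixed (pos τ) τ = insertFixed (pos σ) σ → ¬ pos τ < pos σ := by
      intro τ hτ σ hσ h hlt
      obtain ⟨y, hy⟩ := Fin.exists_succAbove_eq hlt.ne
      have hcy : c' y = i := by rw [← hcc' _ (hpos σ hσ).1, hy, (hpos τ hτ).1]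
      have hy' : y.castSucc < pos σ := by
        rwa [← Fin.succAbove_lt_iff_castSucc_lt, hy]
      -- The earlier position would be a fixed point of the common image, yet `σ` moves every point
      -- of the class before its own switching position.
      refine (((hpos σ hσ).2 y hcy).1 hy').apply_ne ?_
      apply (Fin.succAbove_right_injective (p := pos σ))
      rw [← insertFixed_succAbove, ← h, hy, insertFixed_self]
    intro τ σ hτ hσ h
    have hpq : pos τ = pos σ :=
      le_antisymm (not_lt.1 (hnlt σ hσ τ hτ h.symm)) (not_lt.1 (hnlt τ hτ σ hσ h))
    rw [hpq] at h
    exact insertFixed_injective _ h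
  · rintro π ⟨hπ, hπ'⟩
    have hex : ∃ q, (c q = i ∧ π q = q) ∧ ∀ r < q, c r = i → π r ≠ r := by
      have hne : ∃ q, c q = i ∧ π q = q := by
        by_contra hne
        refine hπ' ⟨hπ.1, fun x hx hfix => ?_⟩
        rcases Finset.mem_insert.1 hx with hx | hx
        · exact hne ⟨x, hx, hfix⟩
        · exact hπ.2 x hx hfix
      obtain ⟨q, hq, hmin⟩ := WellFounded.has_min wellFounded_lt {q | c q = i ∧ π q = q} hne
      exact ⟨q, hq, fun r hr hcr hfix => hmin r ⟨hcr, hfix⟩ hr⟩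
    obtain ⟨q, hqm, hqmin⟩ := hex
    obtain ⟨τ, rfl⟩ := exists_insertFixed_eq hqm.2
    have hmem := (insertFixed_mem_classMonotoneSet_iff hc hiT hqm.1 τ).1 ⟨hπ, fun _ => hqmin⟩
    rw [hcc _ hqm.1] at hmem
    refine ⟨τ, hmem.1, ?_⟩
    have : q = pos τ := huniq τ hmem.1 q ⟨hqm.1, fun y hy => hmem.2 y (by rwa [hcc' _ hqm.1])⟩
    rw [← this]

end Recursion

/-! ### Sorting within the classes -/

section Sorting

variable {ι : Type*} [LinearOrder ι] {n : ℕ}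

/-- The key whose strict monotonicity expresses class-monotonicity of `π`. -/
def classKey (c : Fin n → ι) (S : Finset ι) (π : Perm (Fin n)) (x : Fin n) : ι ×ₗ ℤ :=
  toLex (c x, if c x ∈ S then -((π x : ℕ) : ℤ) else ((π x : ℕ) : ℤ))

theorem classKey_injective (c : Fin n → ι) (S : Finset ι) (π : Perm (Fin n)) :
    Function.Injective (classKey c S π) := by
  intro x y h
  have h := congrArg ofLex h
  simp only [classKey, ofLex_toLex, Prod.mk.injEq] at h
  apply π.injective
  obtain ⟨h1, h2⟩ := h
  rw [h1] at h2
  split_ifs at h2 <;> exact Fin.ext (by omega)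

theorem isClassMonotone_iff_monotone_classKey {c : Fin n → ι} (hc : Monotone c) (S : Finset ι)
    (π : Perm (Fin n)) : IsClassMonotone c S π ↔ Monotone (classKey c S π) := by
  constructor
  · intro h x y hxy
    rcases hxy.eq_or_lt with rfl | hlt
    · exact le_rfl
    rw [classKey, classKey, Prod.Lex.toLex_le_toLex]
    rcases (hc hxy).lt_or_eq with hcl | hce
    · exact .inl hcl
    · refine .inr ⟨hce, ?_⟩
      have := h x y hlt hce
      by_cases hS : c x ∈ S
      · have h' := Fin.lt_def.1 (this.1 hS)
        simp only [← hce, hS, if_true]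
        omega
      · have h' := Fin.lt_def.1 (this.2 hS)
        simp only [← hce, hS, if_false]
        omega
  · intro h x y hlt hce
    have := (h.strictMono_of_injective (classKey_injective c S π)) hlt
    rw [classKey, classKey, Prod.Lex.toLex_lt_toLex, hce] at this
    simp only [lt_irrefl, false_or, true_and] at this
    rw [hce]
    constructor <;> intro hS <;> simp only [hS, if_true, if_false] at this <;> rw [Fin.lt_def] <;>
      omega

theorem classKey_mul {c : Fin n → ι} (S : Finset ι) (π : Perm (Fin n)) {ρ : Perm (Fin n)}
    (hρ : c ∘ ρ = c) : classKey c S (π * ρ) = classKey c S π ∘ ρ := by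
  funext x
  have := congrFun hρ x
  simp only [Function.comp_apply] at this
  simp [classKey, this]

/-- Every permutation is uniquely `α * ρ⁻¹` with `α` class-monotone and `ρ` colour-preserving: `ρ`
must sort the injective `classKey`, which orders by colour and then by signed value. -/
theorem factorial_eq_mul_ncard_classMonotoneSet [Fintype ι] {c : Fin n → ι} (hc : Monotone c)
    (S : Finset ι) :
    n.factorial = (∏ i, ({x | c x = i}.ncard).factorial) * (classMonotoneSet c S ∅).ncard := by
  have h1 : {ρ : Perm (Fin n) | c ∘ ρ = c}.ncard = ∏ i, ({x | c x = i}.ncard).factorial :=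
    DomMulAct.stabilizer_ncard c
  have h2 : (Set.univ : Set (Perm (Fin n))).ncard = n.factorial := by
    rw [Set.ncard_univ, Nat.card_perm, Nat.card_fin]
  rw [← h1, ← h2, ← Set.ncard_prod]
  symm
  have hinv : ∀ ρ : Perm (Fin n), c ∘ ρ = c → c ∘ (ρ⁻¹ : Perm (Fin n)) = c := by
    intro ρ hρ
    funext x
    have := congrFun hρ (ρ⁻¹ x)
    simpa using this.symm
  refine Set.ncard_congr (fun p _ => p.2 * p.1⁻¹) (fun _ _ => trivial) ?_ ?_
  · rintro ⟨ρ, α⟩ ⟨σ, β⟩ ⟨hρ, hα⟩ ⟨hσ, hβ⟩ h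
    dsimp only at h hρ hα hσ hβ
    have hα' := (isClassMonotone_iff_monotone_classKey hc S α).1 hα.1
    have hβ' := (isClassMonotone_iff_monotone_classKey hc S β).1 hβ.1
    have e1 : α = (α * ρ⁻¹) * ρ := by group
    have e2 : β = (α * ρ⁻¹) * σ := by rw [h]; group
    rw [e1, classKey_mul S _ hρ] at hα'
    rw [e2, classKey_mul S _ hσ] at hβ'
    have h3 : ρ = σ := by
      ext x : 1
      exact classKey_injective c S _ (congrFun (Tuple.unique_monotone hα' hβ') x)
    subst h3
    rw [Prod.mk.injEq]
    exact ⟨rfl, mul_right_cancel h⟩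
  · intro π _
    set ρ := Tuple.sort (classKey c S π) with hρdef
    have hmono := Tuple.monotone_sort (classKey c S π)
    rw [← hρdef] at hmono
    have hcρ : c ∘ ρ = c := by
      have hm : Monotone (c ∘ ρ) := by
        intro x y hxy
        have := hmono hxy
        simp only [Function.comp_apply, classKey, Prod.Lex.toLex_le_toLex] at this
        exact this.elim le_of_lt fun h => h.1.le
      -- Both `c ∘ ρ` and `c` are monotone rearrangements of `c`, so they coincide.
      exact Tuple.unique_monotone (τ := 1) hm (by simpa using hc)
    refine ⟨(ρ, π * ρ), ⟨hcρ, ?_, by simp⟩, by simp⟩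
    rw [isClassMonotone_iff_monotone_classKey hc, classKey_mul S π hcρ]
    exact hmono

end Sorting

/-! ### Comparison of the two recursions -/

section Main

variable {ι : Type*} [LinearOrder ι] {n : ℕ}

/-- The constraint on the total length of the cycles inside a colour class: even for colours in
`T ∩ S`, zero for colours in `T \ S`, and none for the other colours. -/
def parityConstraint (S T : Finset ι) (i : ι) : Set ℕ :=
  if i ∈ T then if i ∈ S then {l | Even l} else {0} else Set.univ

theorem update_parityConstraint_univ {S T : Finset ι} {i : ι} (hi : i ∉ T) :
    Function.update (parityConstraint S T) i Set.univ = parityConstraint S T := by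
  rw [Function.update_eq_self_iff, parityConstraint, if_neg hi]

theorem update_parityConstraint_insert (S T : Finset ι) (i : ι) :
    Function.update (parityConstraint S T) i (if i ∈ S then {l | Even l} else {0}) =
      parityConstraint S (insert i T) := by
  funext j
  by_cases h : j = i
  · subst h
    simp [parityConstraint]
  · simp [parityConstraint, h]

/-- `l + 1` is odd iff `l` is even, and `l + 1` is never zero. -/
theorem compl_shift_parity (p : Prop) [Decidable p] :
    {l : ℕ | l + 1 ∉ if p then {l | Even l} else ({0} : Set ℕ)} =
      if p then {l | Even l} else Set.univ := by
  ext l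
  split_ifs
  · simp [Nat.even_add_one]
  · simp

theorem update_parityConstraint_shift {S T : Finset ι} {i : ι} (hi : i ∉ T) :
    Function.update (parityConstraint S T) i
        {l | l + 1 ∉ if i ∈ S then {l | Even l} else ({0} : Set ℕ)} =
      parityConstraint S (if i ∈ S then insert i T else T) := by
  rw [compl_shift_parity]
  by_cases hS : i ∈ S
  · simp only [hS, if_true]
    simpa only [hS, if_true] using update_parityConstraint_insert S T i
  · simp only [hS, if_false]
    exact update_parityConstraint_univ hi

theorem ncard_fiber_comp_succAbove {c : Fin (n + 1) → ι} {i : ι} {p : Fin (n + 1)} (hp : c p = i)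
    {m : ℕ} (hm : {x | c x = i}.ncard = m + 1) :
    (fun j => {y | (c ∘ p.succAbove) y = j}.ncard) =
      Function.update (fun j => {x | c x = j}.ncard) i m := by
  have himg : ∀ j, {y | (c ∘ p.succAbove) y = j}.ncard = ({x | c x = j} \ {p}).ncard := by
    intro j
    rw [← Set.ncard_image_of_injective _ (Fin.succAbove_right_injective (p := p))]
    congr 1
    ext x
    constructor
    · rintro ⟨y, hy, rfl⟩
      exact ⟨hy, Fin.succAbove_ne p y⟩
    · rintro ⟨hx, hxp⟩
      obtain ⟨y, rfl⟩ := Fin.exists_succAbove_eq hxp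
      exact ⟨y, hx, rfl⟩
  funext j
  rw [himg]
  by_cases hj : j = i
  · subst hj
    rw [Function.update_self, Set.ncard_sdiff_singleton_of_mem (by exact hp), hm,
      Nat.add_sub_cancel]
  · rw [Function.update_of_ne hj, Set.sdiff_singleton_eq_self]
    exact fun h => hj (h.symm.trans hp)

theorem prod_factorial_update [Fintype ι] (a : ι → ℕ) (i : ι) (m : ℕ) :
    ∏ j, (Function.update a i (m + 1) j).factorial =
      (m + 1) * ∏ j, (Function.update a i m j).factorial := by
  rw [← Finset.mul_prod_erase _ _ (Finset.mem_univ i),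
    ← Finset.mul_prod_erase (a := i) _ (fun j => (Function.update a i m j).factorial)
      (Finset.mem_univ i),
    Function.update_self, Function.update_self, Nat.factorial_succ, mul_assoc]
  congr 2
  refine Finset.prod_congr rfl fun j hj => ?_
  rw [Function.update_of_ne (Finset.ne_of_mem_erase hj),
    Function.update_of_ne (Finset.ne_of_mem_erase hj)]

theorem constrainedCount_eq_mul_ncard_classMonotoneSet [Fintype ι] (S T : Finset ι) {n : ℕ}
    {c : Fin n → ι} (hc : Monotone c) :
    constrainedCount (fun i => {x | c x = i}.ncard) (parityConstraint S T) =
      (∏ i, ({x | c x = i}.ncard).factorial) * (classMonotoneSet c S T).ncard := by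
  induction T using Finset.induction_on generalizing n with
  | empty =>
    have h : parityConstraint S (∅ : Finset ι) = fun _ => Set.univ := by
      funext i
      simp [parityConstraint]
    rw [h, constrainedCount_univ, ← factorial_eq_mul_ncard_classMonotoneSet hc S]
    congr 1
    have := Finset.card_eq_sum_card_fiberwise (f := c) (s := Finset.univ) (t := Finset.univ)
      fun _ _ => Finset.mem_coe.2 (Finset.mem_univ _)
    rw [Finset.card_univ, Fintype.card_fin] at this
    conv_rhs => rw [this]
    refine Finset.sum_congr rfl fun i _ => ?_
    rw [← Set.ncard_coe_finset]
    simp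
  | insert i T hiT ih =>
    have hP : 0 ∈ if i ∈ S then {l | Even l} else ({0} : Set ℕ) := by split_ifs <;> simp
    -- A second induction, on `n` with `insert i T` fixed, is needed because in the descending case
    -- the smaller instance keeps the condition on `i`.
    induction n with
    | zero =>
      have hz : {x | c x = i}.ncard = 0 := by
        rw [Set.ncard_eq_zero]
        exact Set.eq_empty_of_isEmpty _
      have h := constrainedCount_univ_zero (fun j => {x | c x = j}.ncard) i
        (parityConstraint S T) _ hP
      rw [update_parityConstraint_univ hiT, update_parityConstraint_insert,
        Function.update_eq_self_iff.2 hz.symm, ih hc] at h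
      rw [← h]
      congr 2
      ext π
      simp [classMonotoneSet]
    | succ n ihn =>
      rcases hm : {x | c x = i}.ncard with _ | m
      · have h := constrainedCount_univ_zero (fun j => {x | c x = j}.ncard) i
          (parityConstraint S T) _ hP
        rw [update_parityConstraint_univ hiT, update_parityConstraint_insert,
          Function.update_eq_self_iff.2 hm.symm, ih hc] at h
        rw [← h]
        congr 2
        rw [Set.ncard_eq_zero] at hm
        ext π
        refine and_congr_right fun _ => forall_congr' fun x => ?_
        have hx : c x ≠ i := fun h' => (Set.eq_empty_iff_forall_notMem.1 hm x) h'
        rw [Finset.mem_insert, or_iff_right hx]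
      · obtain ⟨p, hp⟩ : ∃ p, c p = i :=
          Set.nonempty_of_ncard_ne_zero (s := {x | c x = i}) (by rw [hm]; omega)
        have hself : Function.update (fun j => {x | c x = j}.ncard) i (m + 1) =
            fun j => {x | c x = j}.ncard := Function.update_eq_self_iff.2 hm.symm
        have hc' : Monotone (c ∘ p.succAbove) := hc.comp (Fin.strictMono_succAbove p).monotone
        have h := constrainedCount_univ_succ (fun j => {x | c x = j}.ncard) i m
          (parityConstraint S T) _ hP
        have hU : constrainedCount (fun j => {y | (c ∘ p.succAbove) y = j}.ncard)
            (parityConstraint S (if i ∈ S then insert i T else T)) =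
              (∏ j, ({y | (c ∘ p.succAbove) y = j}.ncard).factorial) *
              (classMonotoneSet (c ∘ p.succAbove) S (if i ∈ S then insert i T else T)).ncard := by
          split_ifs
          · exact ihn hc'
          · exact ih hc'
        have hprod := prod_factorial_update (fun j => {x | c x = j}.ncard) i m
        rw [update_parityConstraint_univ hiT, update_parityConstraint_insert,
          update_parityConstraint_shift hiT, hself, ih hc,
          ncard_classMonotoneSet_eq_add (S := S) hc hiT hp, ← ncard_fiber_comp_succAbove hp hm,
          hU, mul_add] at h
        rw [hself, ← ncard_fiber_comp_succAbove hp hm] at hprod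
        rw [← mul_assoc, ← hprod] at h
        exact (Nat.add_right_cancel h).symm

end Main

/-! ### Translation to blocks and small cycles -/

section Blocks

variable {k : ℕ} (a : Fin k → ℕ)

theorem sum_le_eq_sum_lt_add (i : Fin k) :
    ∑ j with j ≤ i, a j = ∑ j with j < i, a j + a i := by
  have : (Finset.univ.filter fun j => j ≤ i) = insert i (Finset.univ.filter fun j => j < i) := by
    ext j
    simp [le_iff_eq_or_lt]
  rw [this, Finset.sum_insert (by simp), add_comm]

theorem sum_le_le_sum_lt {i j : Fin k} (hij : i < j) :
    ∑ l with l ≤ i, a l ≤ ∑ l with l < j, a l := by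
  refine Finset.sum_le_sum_of_subset fun l hl => ?_
  simp only [Finset.mem_filter, Finset.mem_univ, true_and] at hl ⊢
  exact hl.trans_lt hij

theorem exists_mem_ascDescBlock (x : Fin (∑ j, a j)) : ∃ i, x ∈ ascDescBlock a i := by
  have hex : ∃ i, (x : ℕ) < ∑ j with j ≤ i, a j := by
    have hk : 0 < k := by
      rcases Nat.eq_zero_or_pos k with rfl | h
      · exact absurd x.2 (by simp)
      · exact h
    refine ⟨⟨k - 1, by omega⟩, ?_⟩
    have : (Finset.univ.filter fun j : Fin k => j ≤ ⟨k - 1, by omega⟩) = Finset.univ := by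
      ext j
      simp only [Finset.mem_filter, Finset.mem_univ, true_and, iff_true, Fin.le_def]
      omega
    rw [this]
    exact x.2
  obtain ⟨i, hi, hmin⟩ := WellFounded.has_min wellFounded_lt
    {i | (x : ℕ) < ∑ j with j ≤ i, a j} hex
  refine ⟨i, ?_⟩
  simp only [ascDescBlock, Finset.mem_filter, Finset.mem_univ, true_and]
  refine ⟨?_, hi⟩
  by_cases h0 : (i : ℕ) = 0
  · have : (Finset.univ.filter fun j : Fin k => j < i) = ∅ := by
      ext j
      simp [Fin.lt_def, h0]
    simp [this]
  · have hj : (⟨i - 1, by omega⟩ : Fin k) < i := by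
      rw [Fin.lt_def]
      simp only
      omega
    have h1 : ∑ j with j ≤ (⟨i - 1, by omega⟩ : Fin k), a j ≤ x := not_lt.1 fun h => hmin _ h hj
    have : (Finset.univ.filter fun j : Fin k => j < i) =
        Finset.univ.filter fun j => j ≤ ⟨i - 1, by omega⟩ := by
      ext j
      simp only [Finset.mem_filter, Finset.mem_univ, true_and, Fin.lt_def, Fin.le_def]
      omega
    rw [this]
    exact h1

/-- The index of the block containing a given position. -/
noncomputable def blockIndex (x : Fin (∑ j, a j)) : Fin k :=
  (exists_mem_ascDescBlock a x).choose

theorem le_of_mem_ascDescBlock {x y : Fin (∑ j, a j)} {i j : Fin k} (hx : x ∈ ascDescBlock a i)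
    (hy : y ∈ ascDescBlock a j) (hxy : x ≤ y) : i ≤ j := by
  simp only [ascDescBlock, Finset.mem_filter, Finset.mem_univ, true_and] at hx hy
  by_contra hij
  have := sum_le_le_sum_lt a (not_le.1 hij)
  have := Fin.le_def.1 hxy
  omega

theorem mem_ascDescBlock_iff (x : Fin (∑ j, a j)) (i : Fin k) :
    x ∈ ascDescBlock a i ↔ blockIndex a x = i := by
  have h := (exists_mem_ascDescBlock a x).choose_spec
  constructor
  · intro hx
    exact le_antisymm (le_of_mem_ascDescBlock a h hx le_rfl) (le_of_mem_ascDescBlock a hx h le_rfl)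
  · rintro rfl
    exact h

theorem monotone_blockIndex : Monotone (blockIndex a) := fun x y hxy =>
  le_of_mem_ascDescBlock a ((mem_ascDescBlock_iff a x _).2 rfl) ((mem_ascDescBlock_iff a y _).2 rfl)
    hxy

theorem ncard_blockIndex_fiber (i : Fin k) : {x | blockIndex a x = i}.ncard = a i := by
  have hle : ∑ j with j < i, a j + a i ≤ ∑ j, a j := by
    rw [← sum_le_eq_sum_lt_add]
    exact Finset.sum_le_sum_of_subset (Finset.filter_subset _ _)
  have h1 : {x | blockIndex a x = i} = (ascDescBlock a i : Set (Fin (∑ j, a j))) := by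
    ext x
    exact (mem_ascDescBlock_iff a x i).symm
  have h2 : (ascDescBlock a i).map Fin.valEmbedding =
      Finset.Ico (∑ j with j < i, a j) (∑ j with j < i, a j + a i) := by
    ext m
    simp only [ascDescBlock, Finset.mem_map, Finset.mem_filter, Finset.mem_univ, true_and,
      Fin.valEmbedding_apply, Finset.mem_Ico, ← sum_le_eq_sum_lt_add]
    constructor
    · rintro ⟨x, hx, rfl⟩
      exact hx
    · intro hm
      rw [← sum_le_eq_sum_lt_add] at hle
      exact ⟨⟨m, hm.2.trans_le hle⟩, hm, rfl⟩
  rw [h1, Set.ncard_coe_finset, ← Finset.card_map Fin.valEmbedding, h2, Nat.card_Ico,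
    Nat.add_sub_cancel_left]

theorem mem_classMonotoneSet_blockIndex_iff (S : Finset (Fin k)) (π : Perm (Fin (∑ j, a j))) :
    π ∈ classMonotoneSet (blockIndex a) S Finset.univ ↔ IsASDerangement a S π := by
  refine and_congr ?_ (by simp [derangements])
  constructor
  · intro h
    refine ⟨fun i hi x hx y hy hxy => ?_, fun i hi x hx y hy hxy => ?_⟩ <;>
      rw [Finset.mem_coe, mem_ascDescBlock_iff] at hx hy
    · exact (h x y hxy (hx.trans hy.symm)).1 (hx ▸ hi)
    · exact (h x y hxy (hx.trans hy.symm)).2 (hx ▸ hi)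
  · intro h x y hxy hc
    have hx := Finset.mem_coe.2 ((mem_ascDescBlock_iff a x _).2 hc)
    have hy := Finset.mem_coe.2 ((mem_ascDescBlock_iff a y _).2 rfl)
    exact ⟨fun hS => h.1 _ (hc ▸ hS) hx hy hxy, fun hS => h.2 _ (hc ▸ hS) hx hy hxy⟩

theorem biUnion_smallCycles (π : Perm (Fin (∑ j, a j))) (i : Fin k) :
    ((smallCycles a π i).biUnion id : Set (Fin (∑ j, a j))) = innerPart (blockIndex a) π i := by
  ext x
  simp only [smallCycles, permCycles, Finset.coe_biUnion, Finset.coe_filter, Finset.mem_image,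
    Finset.mem_univ, true_and, Set.mem_ofPred_eq, id, Set.mem_iUnion, exists_prop, innerPart]
  constructor
  · rintro ⟨_, ⟨⟨z, rfl⟩, hz⟩, hx⟩ y hy
    rw [← mem_ascDescBlock_iff]
    simp only [Finset.coe_filter, Finset.mem_univ, true_and, Set.mem_ofPred_eq] at hx
    exact hz (by simpa using hx.trans hy)
  · intro hx
    refine ⟨_, ⟨⟨x, rfl⟩, fun y hy => ?_⟩, by simpa using Perm.SameCycle.refl π x⟩
    rw [mem_ascDescBlock_iff]
    exact hx y (by simpa using hy)

theorem sum_card_smallCycles (π : Perm (Fin (∑ j, a j))) (i : Fin k) :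
    ∑ c ∈ smallCycles a π i, c.card = (innerPart (blockIndex a) π i).ncard := by
  rw [← biUnion_smallCycles, Set.ncard_coe_finset, Finset.card_biUnion]
  · rfl
  intro c hc d hd hcd
  simp only [smallCycles, permCycles, Finset.coe_filter, Finset.mem_image,
    Finset.mem_univ, true_and] at hc hd
  obtain ⟨⟨x, rfl⟩, -⟩ := hc
  obtain ⟨⟨y, rfl⟩, -⟩ := hd
  refine Finset.disjoint_left.2 fun z hz hz' => hcd ?_
  simp only [id, Finset.mem_filter, Finset.mem_univ, true_and] at hz hz'
  ext w
  have hxy : π.SameCycle x y := hz.trans hz'.symm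
  simp only [Finset.mem_filter, Finset.mem_univ, true_and]
  exact ⟨hxy.symm.trans, hxy.trans⟩

/-- Cycles are nonempty, so there are none in the block exactly when their total length vanishes. -/
theorem smallCycles_eq_empty_iff (π : Perm (Fin (∑ j, a j))) (i : Fin k) :
    smallCycles a π i = ∅ ↔ (innerPart (blockIndex a) π i).ncard = 0 := by
  rw [← sum_card_smallCycles, Finset.sum_eq_zero_iff]
  constructor
  · intro h
    simp [h]
  · intro h
    refine Finset.eq_empty_of_forall_notMem fun c hc => ?_
    have hcard := Finset.card_eq_zero.1 (h c hc)
    simp only [smallCycles, permCycles, Finset.mem_filter, Finset.mem_image, Finset.mem_univ,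
      true_and] at hc
    obtain ⟨⟨x, rfl⟩, -⟩ := hc
    exact Finset.notMem_empty x (hcard ▸ by simpa using Perm.SameCycle.refl π x)

theorem mem_innerConstrained_blockIndex_iff (S : Finset (Fin k)) (π : Perm (Fin (∑ j, a j))) :
    π ∈ innerConstrained (blockIndex a) (parityConstraint S Finset.univ) ↔
      (∀ i ∉ S, smallCycles a π i = ∅) ∧ ∀ i ∈ S, Even (∑ c ∈ smallCycles a π i, c.card) := by
  simp only [smallCycles_eq_empty_iff, sum_card_smallCycles, innerConstrained, Set.mem_ofPred_eq,
    parityConstraint, Finset.mem_univ, if_true]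
  constructor
  · intro h
    refine ⟨fun i hi => ?_, fun i hi => ?_⟩
    · simpa [hi] using h i
    · simpa [hi] using h i
  · rintro ⟨h1, h2⟩ i
    by_cases hi : i ∈ S
    · simpa [hi] using h2 i hi
    · simpa [hi] using h1 i hi

end Blocks

theorem theorem5p3 (k : ℕ) (a : Fin k → ℕ) (S : Finset (Fin k)) :
    Nat.card {π : Equiv.Perm (Fin (∑ j, a j)) //
        (∀ i ∉ S, smallCycles a π i = ∅) ∧
          ∀ i ∈ S, Even (∑ c ∈ smallCycles a π i, c.card)} =
      (∏ i, (a i).factorial) *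
        Nat.card {π : Equiv.Perm (Fin (∑ j, a j)) // IsASDerangement a S π} := by
  have h := constrainedCount_eq_mul_ncard_classMonotoneSet S Finset.univ (monotone_blockIndex a)
  rw [← ncard_innerConstrained] at h
  simp only [ncard_blockIndex_fiber] at h
  rw [← Nat.card_coe_set_eq, ← Nat.card_coe_set_eq] at h
  rw [Nat.card_congr (Equiv.subtypeEquivRight fun π =>
      (mem_innerConstrained_blockIndex_iff a S π).symm),
    Nat.card_congr (Equiv.subtypeEquivRight fun π =>
      (mem_classMonotoneSet_blockIndex_iff a S π).symm)]
  exact h
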